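/- Let $q,m\ge 0$, $n=q+m$, and let $\mathbb D^d\subset\mathbb C^d$ be the unit polydisc. Let $B=\mathbb D^q\times\mathbb D^m$, with coordinates $x=(x',x'')$, be a flow box of a Lipschitz lamination of dimension $q$: for $a$ in a set $K\subset\mathbb D^m$ (the transversal) the plaques are the pairwise disjoint graphs $L_a=\{x''=h_a(x')\}$, where $h_a:\mathbb D^q\to\mathbb D^m$ is holomorphic, $h_a(0)=a$, $h_a(x')$ is jointly continuous in $(a,x')$, and for every $0<\rho<1$ there is $c=c(\rho)>0$ such that $$c^{-1}\|a-b\|\le \|h_a(x')-h_b(x')\|\le c\,\|a-b\|\qquad (a,b\in K,\ \|x'\|\le\rho).$$ Let $\mu$ be a positive Borel measure, concentrated on $K$, finite on compact subsets of $\mathbb D^m$ and diffuse (i.e. $\mu(\{a\})=0$ for every $a$), and let $T=\int[L_a]\,d\mu(a)$. On $B\times B$, with coordinates $(x,y)$, put $(z,w)=(x,y-x)$, $z=(z',z'')$, $w=(w',w'')$, so that the diagonal is $\{w=0\}$, and use the parameters $\alpha=(\alpha_1,\alpha_2)=(a,b-a)$. In these coordinates $L_a\times L_b$ is the graph $$\Gamma_\alpha=\{(z',f_\alpha(z',w'),w',g_\alpha(z',w'))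 : z'\in\mathbb D^q,\ z'+w'\in\mathbb D^q\},$$ with $f_\alpha(z',w')=h_{\alpha_1}(z')$ and $g_\alpha(z',w')=h_{\alpha_1+\alpha_2}(z'+w')-h_{\alpha_1}(z')$, and $$\mathbf T=T\otimes T=\int[\Gamma_\alpha]\,d\mathfrak M(\alpha),$$ where $\mathfrak M$ is the image of $\mu\otimes\mu$ under $(a,b)\mapsto(a,b-a)$ and $[\Gamma_\alpha]$ is the current of integration on $\Gamma_\alpha$. For $\lambda\in\mathbb C$, $|\lambda|\ge1$, let $A_\lambda(z,w)=(z,\lambda w)$ and $\mathbf T_\lambda=(A_\lambda)_*\mathbf T$. Then there is an open neighbourhood $U$ of the origin in $\mathbb C^n\times\mathbb C^n$, contained in the image under $A_\lambda$ of the box $B\times B$ (in the coordinates $(z,w)$) for all $|\lambda|\ge1$, such that all $\mathbf T_\lambda$ with $|\lambda|\ge 1$ are well-defined currents on $U$ (the defining integrals converge absolutely and define continuous functionals on test forms) and $$\lim_{|\lambda|\to\infty}\mathbf T_\lambda=0\quad\text{weakly on }U,$$ that is, $\langle\mathbf T_\lambda,\varphi\rangle\to0$ for every smooth complex-valued form $\varphi$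 of degree $4q$ with compact support in $U$. -/

import Mathlib

open MeasureTheory Filter Topology TopologicalSpace
open scoped Distributions

noncomputable section

namespace FoliatedCycle

/-- `ℂ^d` with the sup norm, so that the unit polydisc is the unit ball. -/
abbrev Cn (d : ℕ) : Type := Fin d → ℂ

/-- The unit polydisc `𝔻^d`. -/
def polydisc (d : ℕ) : Set (Cn d) := Metric.ball 0 1

/-- `ℂ^n = ℂ^q × ℂ^m` with `m = n - q`; points are written `x = (x', x'')`. -/
abbrev Coord (q m : ℕ) : Type := Cn q × Cn m

/-! ### Forms and currents -/

/-- Complex valued real-alternating `k`-covectors on `V`; a differential form of degree `k` is a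
map `V → Covector V k`. -/
abbrev Covector (V : Type*) [NormedAddCommGroup V] [NormedSpace ℝ V] (k : ℕ) : Type _ :=
  V [⋀^Fin k]→L[ℝ] ℂ

/-- The pull-back `F^* φ` of a differential form. -/
def pullback {V W : Type*} [NormedAddCommGroup V] [NormedSpace ℝ V] [NormedAddCommGroup W]
    [NormedSpace ℝ W] {k : ℕ} (F : V → W) (φ : W → Covector W k) : V → Covector V k :=
  fun p => (φ (F p)).compContinuousLinearMap (fderiv ℝ F p)

/-- The push-forward `⟨F_* S, φ⟩ = ⟨S, F^* φ⟩` of a functional on forms. -/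
def pushforward {V W : Type*} [NormedAddCommGroup V] [NormedSpace ℝ V] [NormedAddCommGroup W]
    [NormedSpace ℝ W] {k : ℕ} (F : V → W) (S : (V → Covector V k) → ℂ) :
    (W → Covector W k) → ℂ :=
  fun φ => S (pullback F φ)

/-- Smooth complex valued `k`-forms with compact support in the open set `U`, with the usual
locally convex inductive limit topology. -/
abbrev TestForm {V : Type*} [NormedAddCommGroup V] [NormedSpace ℝ V] (U : Opens V) (k : ℕ) :
    Type _ :=
  𝓓(U, Covector V k)

/-- Currents of (real) dimension `k` on `U`: continuous linear functionals on test `k`-forms. -/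
abbrev Current {V : Type*} [NormedAddCommGroup V] [NormedSpace ℝ V] (U : Opens V) (k : ℕ) :
    Type _ :=
  TestForm U k →L[ℝ] ℂ

/-- The standard positively oriented real frame `∂/∂x_1, ∂/∂y_1, …, ∂/∂x_d, ∂/∂y_d` of `ℂ^d`. -/
def realFrame (d : ℕ) : Fin (2 * d) → Cn d :=
  fun j => Pi.single ⟨(j : ℕ) / 2, by omega⟩ (if (j : ℕ) % 2 = 0 then 1 else Complex.I)

/-- The standard positively oriented real frame of `ℂ^q × ℂ^q`. -/
def prodFrame (q : ℕ) : Fin (2 * q + 2 * q) → Cn q × Cn q :=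
  Fin.append (fun j => (realFrame q j, 0)) (fun j => (0, realFrame q j))

/-! ### Flow boxes -/

/-- A flow box `B = 𝔻^q × 𝔻^m` of an embedded lamination of dimension `q`, in holomorphic
coordinates `x = (x', x'')`. The plaques are the pairwise disjoint graphs
`L_a = {x'' = h_a(x')}`, where `h_a : 𝔻^q → 𝔻^m` is holomorphic and depends continuously on
`a = h_a(0)`, for `a` in the transversal `K ⊆ 𝔻^m`. Values of `h` for other `a` are irrelevant. -/
structure FlowBox (q m : ℕ) where
  /-- the transversal `K` -/
  transversal : Set (Cn m)
  /-- the functions `h_a` -/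
  h : Cn m → Cn q → Cn m
  transversal_subset : transversal ⊆ polydisc m
  holomorphic : ∀ a ∈ transversal, DifferentiableOn ℂ (h a) (polydisc q)
  mapsTo : ∀ a ∈ transversal, Set.MapsTo (h a) (polydisc q) (polydisc m)
  h_zero : ∀ a ∈ transversal, h a 0 = a
  continuousOn : ContinuousOn (fun p : Cn m × Cn q => h p.1 p.2) (transversal ×ˢ polydisc q)
  disjoint : ∀ a ∈ transversal, ∀ b ∈ transversal, a ≠ b → ∀ x ∈ polydisc q, h a x ≠ h b x

namespace FlowBox

variable {q m : ℕ}

/-- The lamination is (transversally) Lipschitz: `h_a` depends on `a` in a bi-Lipschitz way,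
uniformly over each smaller polydisc. -/
def IsLipschitz (B : FlowBox q m) : Prop :=
  ∀ ρ : ℝ, 0 < ρ → ρ < 1 → ∃ c : ℝ, 0 < c ∧
    ∀ a ∈ B.transversal, ∀ b ∈ B.transversal, ∀ x : Cn q, ‖x‖ ≤ ρ →
      c⁻¹ * ‖a - b‖ ≤ ‖B.h a x - B.h b x‖ ∧ ‖B.h a x - B.h b x‖ ≤ c * ‖a - b‖

/-- `f_α(z', w') = h_{α₁}(z')`. -/
def f (B : FlowBox q m) (α : Cn m × Cn m) (p : Cn q × Cn q) : Cn m :=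
  B.h α.1 p.1

/-- `g_α(z', w') = h_{α₁ + α₂}(z' + w') - h_{α₁}(z')`. -/
def g (B : FlowBox q m) (α : Cn m × Cn m) (p : Cn q × Cn q) : Cn m :=
  B.h (α.1 + α.2) (p.1 + p.2) - B.h α.1 p.1

/-- The parametrization `(z', w') ↦ (z', f_α(z', w'), w', g_α(z', w'))` of `Γ_α`, which is the
product plaque `L_a × L_b`, `a = α₁`, `b = α₁ + α₂`, in the coordinates `(z, w) = (x, y - x)`. -/
def graph (B : FlowBox q m) (α : Cn m × Cn m) (p : Cn q × Cn q) : Coord q m × Coord q m :=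
  ((p.1, B.f α p), (p.2, B.g α p))

end FlowBox

/-- The set of `(z', w') = (x', y' - x')` with `x', y' ∈ 𝔻^q`, over which `Γ_α` is a graph. -/
def graphDomain (q : ℕ) : Set (Cn q × Cn q) :=
  {p | p.1 ∈ polydisc q ∧ p.1 + p.2 ∈ polydisc q}

/-- The product flow box `B × B` in the coordinates `(z, w) = (x, y - x)`. -/
def productBox (q m : ℕ) : Set (Coord q m × Coord q m) :=
  {p | p.1 ∈ polydisc q ×ˢ polydisc m ∧ p.1 + p.2 ∈ polydisc q ×ˢ polydisc m}

/-- The dilation `A_l (z, w) = (z, l w)`. -/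
def dilation {q m : ℕ} (l : ℂ) (p : Coord q m × Coord q m) : Coord q m × Coord q m :=
  (p.1, l • p.2)

/-- The measure `μ ⊗ μ` in the parameters `α = (a, b - a)`. -/
def productMeasure {m : ℕ} (μ : Measure (Cn m)) : Measure (Cn m × Cn m) :=
  (μ.prod μ).map fun p => (p.1, p.2 - p.1)

namespace FlowBox

variable {q m : ℕ}

/-- The density, with respect to Lebesgue measure in `(z', w')`, of the restriction of the form `φ`
to `Γ_α`. -/
def plaqueDensity (B : FlowBox q m) (α : Cn m × Cn m)
    (φ : Coord q m × Coord q m → Covector (Coord q m × Coord q m) (2 * q + 2 * q))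
    (p : Cn q × Cn q) : ℂ :=
  pullback (B.graph α) φ p (prodFrame q)

/-- The current of integration `⟨[Γ_α], φ⟩ = ∫_{Γ_α} φ`. -/
def plaqueCurrent (B : FlowBox q m) (α : Cn m × Cn m)
    (φ : Coord q m × Coord q m → Covector (Coord q m × Coord q m) (2 * q + 2 * q)) : ℂ :=
  ∫ p in graphDomain q, B.plaqueDensity α φ p

/-- The product cycle `T ⊗ T = ∫ [Γ_α] d(μ ⊗ μ)(α)` in the coordinates `(z, w)`. -/
def productCycle (B : FlowBox q m) (μ : Measure (Cn m))
    (φ : Coord q m × Coord q m → Covector (Coord q m × Coord q m) (2 * q + 2 * q)) : ℂ :=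
  ∫ α, B.plaqueCurrent α φ ∂(productMeasure μ)

/-- The integrals that define `⟨T ⊗ T, φ⟩` converge. -/
def PairingConverges (B : FlowBox q m) (μ : Measure (Cn m))
    (φ : Coord q m × Coord q m → Covector (Coord q m × Coord q m) (2 * q + 2 * q)) : Prop :=
  (∀ᵐ α ∂(productMeasure μ), IntegrableOn (B.plaqueDensity α φ) (graphDomain q)) ∧
    Integrable (fun α => B.plaqueCurrent α φ) (productMeasure μ)

end FlowBox

end FoliatedCycle

end

/-! ### Cauchy estimates for the plaques. -/

noncomputable section

namespace FoliatedCycle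

namespace FlowBox

variable {q m : ℕ} {B : FlowBox q m}

/-! Work on the ball of radius `1/32` and suppose that a dilated plaque with parameters `a`, `b`
meets it over `(x, w)`. Both `w` and `h_b(x + w) - h_a(x)` are then `O(1/|l|)`. Since `h_b` is
Lipschitz by Cauchy's estimate, `h_b(x) - h_a(x)` is `O(1/|l|)` too, and the lower Lipschitz bound
gives `‖a - b‖ ≤ c/|l|`.

The slopes stay bounded: by the upper Lipschitz bound, `t ↦ h_b(t + w) - h_a(t)` is holomorphic of
size `O(1/|l|)` near `x`, so by Cauchy its differential is `O(1/|l|)`, which absorbs the factor `l`.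
Thus the `2q` directions along `z'` have bounded images, while the `2q` directions along `w'` grow
like `|l|`. The resulting `|l|^(2q)` is cancelled by the volume of the `w'`-ball of radius
`1/(32|l|)`. These facts are `dilatedGraph_estimates` and `volume_real_shrunkBox`.

Each plaque therefore contributes at most a constant times the sup norm of the form, and only pairs
with `‖a - b‖ ≤ c/|l|` in a fixed compact set contribute (`exists_norm_productCycle_le`). For fixed
`l` this gives convergence and continuity. As `|l| → ∞` the mass of these pairs tends to that of a
part of the diagonal, which is zero because `μ` is diffuse (`tendsto_prod_nearDiagonal`). -/

lemma differentiableAt {a : Cn m} (ha : a ∈ B.transversal) {x : Cn q} (hx : x ∈ polydisc q) :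
    DifferentiableAt ℂ (B.h a) x :=
  (B.holomorphic a ha).differentiableAt (Metric.isOpen_ball.mem_nhds hx)

lemma norm_h_lt_one {a : Cn m} (ha : a ∈ B.transversal) {x : Cn q} (hx : ‖x‖ < 1) :
    ‖B.h a x‖ < 1 :=
  mem_ball_zero_iff.1 (B.mapsTo a ha (mem_ball_zero_iff.2 hx))

end FlowBox

/-- Cauchy's estimate for the differential of a bounded holomorphic map. -/
lemma norm_fderiv_le_of_norm_le {E F : Type*} [NormedAddCommGroup E] [NormedSpace ℂ E]
    [NormedAddCommGroup F] [NormedSpace ℂ F] {f : E → F} {x : E} {δ M : ℝ} (hδ : 0 < δ)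
    (hf : DifferentiableOn ℂ f (Metric.ball x δ)) (hM : ∀ t ∈ Metric.ball x δ, ‖f t‖ ≤ M) :
    ‖fderiv ℂ f x‖ ≤ 2 * M / δ := by
  refine Complex.norm_fderiv_le_div_of_mapsTo_ball hf (fun t ht => ?_) hδ
  rw [mem_closedBall_iff_norm]
  linarith [norm_sub_le (f t) (f x), hM t ht, hM x (Metric.mem_ball_self hδ)]

namespace FlowBox

variable {q m : ℕ} {B : FlowBox q m}

lemma norm_fderiv_h_le {a : Cn m} (ha : a ∈ B.transversal) {x : Cn q} {δ : ℝ} (hδ : 0 < δ)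
    (hx : ‖x‖ + δ ≤ 1) : ‖fderiv ℂ (B.h a) x‖ ≤ 2 / δ := by
  have hsub : Metric.ball x δ ⊆ polydisc q := by
    refine Metric.ball_subset_ball' ?_
    rw [dist_zero_right]; linarith
  have := norm_fderiv_le_of_norm_le hδ ((B.holomorphic a ha).mono hsub) (M := 1)
    fun t ht => (norm_h_lt_one ha (mem_ball_zero_iff.1 (hsub ht))).le
  simpa using this

lemma norm_h_sub_h_le {a : Cn m} (ha : a ∈ B.transversal) {x y : Cn q} {δ : ℝ} (hδ : 0 < δ)
    (hx : ‖x‖ + δ ≤ 1) (hy : ‖y‖ + δ ≤ 1) : ‖B.h a y - B.h a x‖ ≤ 2 / δ * ‖y - x‖ := by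
  refine Convex.norm_image_sub_le_of_norm_fderiv_le (𝕜 := ℂ)
    (s := Metric.closedBall (0 : Cn q) (1 - δ)) (fun t ht => ?_) (fun t ht => ?_)
    (convex_closedBall _ _) ?_ ?_
  · rw [mem_closedBall_zero_iff] at ht
    exact differentiableAt ha (mem_ball_zero_iff.2 (by linarith))
  · rw [mem_closedBall_zero_iff] at ht
    exact norm_fderiv_h_le ha hδ (by linarith)
  · rw [mem_closedBall_zero_iff]; linarith
  · rw [mem_closedBall_zero_iff]; linarith

/-- The differentials of the plaques are Lipschitz in the plaque and in the base point. -/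
lemma norm_fderiv_h_sub_fderiv_h_le {a b : Cn m} (ha : a ∈ B.transversal) (hb : b ∈ B.transversal)
    {x w : Cn q} {c δ : ℝ} (hδ : 0 < δ) (hx : ‖x‖ + 3 * δ ≤ 1) (hw : ‖w‖ ≤ δ)
    (hc : ∀ t : Cn q, ‖t‖ ≤ ‖x‖ + δ → ‖B.h a t - B.h b t‖ ≤ c * ‖a - b‖) :
    ‖fderiv ℂ (B.h b) (x + w) - fderiv ℂ (B.h a) x‖ ≤ 2 * (2 / δ * ‖w‖ + c * ‖a - b‖) / δ := by
  have hball : ∀ t ∈ Metric.ball x δ, ‖t‖ < ‖x‖ + δ := fun t ht => by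
    rw [mem_ball_iff_norm] at ht
    linarith [norm_sub_norm_le t x]
  -- The difference of differentials is itself the differential of one holomorphic map, so Cauchy's
  -- estimate applies to it. The margin `3δ` keeps `t + w` at distance at least `δ` from the
  -- boundary.
  have hdiff : ∀ t ∈ Metric.ball x δ,
      HasFDerivAt (fun t => B.h b (t + w) - B.h a t)
        (fderiv ℂ (B.h b) (t + w) - fderiv ℂ (B.h a) t) t := fun t ht => by
    have h1 := hball t ht
    have h2 : t + w ∈ polydisc q := mem_ball_zero_iff.2 (by linarith [norm_add_le t w])
    have h3 : t ∈ polydisc q := mem_ball_zero_iff.2 (by linarith)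
    have h4 : HasFDerivAt (fun t => B.h b (t + w)) (fderiv ℂ (B.h b) (t + w)) t :=
      (hasFDerivAt_comp_add_right w).2 (differentiableAt hb h2).hasFDerivAt
    exact h4.sub (differentiableAt ha h3).hasFDerivAt
  rw [← (hdiff x (Metric.mem_ball_self hδ)).fderiv]
  refine norm_fderiv_le_of_norm_le hδ
    (fun t ht => (hdiff t ht).differentiableAt.differentiableWithinAt) fun t ht => ?_
  have h1 := hball t ht
  have h2 := norm_h_sub_h_le hb (x := t) (y := t + w) hδ (by linarith)
    (by linarith [norm_add_le t w])
  rw [add_sub_cancel_left] at h2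
  have h3 := hc t h1.le
  rw [norm_sub_rev] at h3
  calc ‖B.h b (t + w) - B.h a t‖
      = ‖(B.h b (t + w) - B.h b t) + (B.h b t - B.h a t)‖ := by rw [sub_add_sub_cancel]
    _ ≤ _ := (norm_add_le _ _).trans (add_le_add h2 h3)

/-- Only `h` is assumed jointly continuous; for its differential this follows from the preceding
estimate, whose right side vanishes as `w → 0` and `b → a`. -/
lemma continuousOn_fderiv_h (hB : B.IsLipschitz) :
    ContinuousOn (fun p : Cn m × Cn q => fderiv ℂ (B.h p.1) p.2)
      (B.transversal ×ˢ polydisc q) := by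
  rintro ⟨a, x⟩ ⟨ha, hx⟩
  simp only at ha hx
  have hx1 : ‖x‖ < 1 := mem_ball_zero_iff.1 hx
  obtain ⟨c, -, hc⟩ := hB ((1 + ‖x‖) / 2) (by positivity) (by linarith)
  -- Here `‖x‖ + 3δ = 1` and `‖x‖ + δ ≤ (1 + ‖x‖)/2`, the radius for which `c` was chosen.
  set δ : ℝ := (1 - ‖x‖) / 3 with hδ
  have hδ0 : 0 < δ := by rw [hδ]; linarith
  rw [ContinuousWithinAt, tendsto_iff_norm_sub_tendsto_zero]
  have hlim : Tendsto (fun p : Cn m × Cn q => 2 * (2 / δ * ‖p.2 - x‖ + c * ‖a - p.1‖) / δ)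
      (𝓝[B.transversal ×ˢ polydisc q] (a, x)) (𝓝 0) := by
    have : Continuous fun p : Cn m × Cn q => 2 * (2 / δ * ‖p.2 - x‖ + c * ‖a - p.1‖) / δ := by
      fun_prop
    simpa using (this.tendsto (a, x)).mono_left nhdsWithin_le_nhds
  refine squeeze_zero' (Eventually.of_forall fun _ => norm_nonneg _) ?_ hlim
  have hnear : ∀ᶠ p : Cn m × Cn q in 𝓝[B.transversal ×ˢ polydisc q] (a, x), ‖p.2 - x‖ < δ := by
    have : Continuous fun p : Cn m × Cn q => ‖p.2 - x‖ := by fun_prop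
    exact nhdsWithin_le_nhds ((this.tendsto (a, x)).eventually_lt_const (by simpa using hδ0))
  filter_upwards [hnear, self_mem_nhdsWithin] with p hp hpK
  have := norm_fderiv_h_sub_fderiv_h_le ha hpK.1 (x := x) (w := p.2 - x) (c := c) hδ0
    (by rw [hδ]; linarith) hp.le (fun t ht => (hc a ha p.1 hpK.1 t (by rw [hδ] at ht; linarith)).2)
  simpa using this

/-! ### The dilated plaques -/

/-- The point of `A_l (Γ_α)` over `p`, for `α = (a, b - a)`. -/
def dilatedGraph (B : FlowBox q m) (l : ℂ) (a b : Cn m) (p : Cn q × Cn q) :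
    Coord q m × Coord q m :=
  ((p.1, B.h a p.1), (l • p.2, l • (B.h b (p.1 + p.2) - B.h a p.1)))

/-- The differential at `p` of the parametrization `dilatedGraph`, in the direction `v`. -/
def dilatedTangent (B : FlowBox q m) (l : ℂ) (a b : Cn m) (p v : Cn q × Cn q) :
    Coord q m × Coord q m :=
  ((v.1, fderiv ℂ (B.h a) p.1 v.1),
    (l • v.2, l • (fderiv ℂ (B.h b) (p.1 + p.2) (v.1 + v.2) - fderiv ℂ (B.h a) p.1 v.1)))

/-- Chain rule, with real differentials obtained by restricting scalars from the complex ones. The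
pairing thereby becomes an explicit expression in `h` and its differential. -/
lemma plaqueDensity_pullback_dilation {a b : Cn m} (ha : a ∈ B.transversal)
    (hb : b ∈ B.transversal) {p : Cn q × Cn q} (hp : p ∈ graphDomain q) (l : ℂ)
    (φ : Coord q m × Coord q m → Covector (Coord q m × Coord q m) (2 * q + 2 * q)) :
    B.plaqueDensity (a, b - a) (pullback (dilation l) φ) p =
      φ (B.dilatedGraph l a b p) (fun j => B.dilatedTangent l a b p (prodFrame q j)) := by
  have hg : HasFDerivAt (𝕜 := ℂ) (B.graph (a, b - a))
      (((ContinuousLinearMap.fst ℂ (Cn q) (Cn q)).prod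
          ((fderiv ℂ (B.h a) p.1).comp (.fst ℂ (Cn q) (Cn q)))).prod
        ((ContinuousLinearMap.snd ℂ (Cn q) (Cn q)).prod
          ((fderiv ℂ (B.h b) (p.1 + p.2)).comp (.fst ℂ (Cn q) (Cn q) + .snd ℂ (Cn q) (Cn q)) -
            (fderiv ℂ (B.h a) p.1).comp (.fst ℂ (Cn q) (Cn q))))) p := by
    have h1 : HasFDerivAt (fun p : Cn q × Cn q => B.h a p.1)
        ((fderiv ℂ (B.h a) p.1).comp (.fst ℂ (Cn q) (Cn q))) p :=
      (differentiableAt ha hp.1).hasFDerivAt.comp p hasFDerivAt_fst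
    have h2 : HasFDerivAt (fun p : Cn q × Cn q => B.h b (p.1 + p.2))
        ((fderiv ℂ (B.h b) (p.1 + p.2)).comp (.fst ℂ (Cn q) (Cn q) + .snd ℂ (Cn q) (Cn q))) p :=
      HasFDerivAt.comp (f := fun p : Cn q × Cn q => p.1 + p.2) p
        (differentiableAt hb hp.2).hasFDerivAt (hasFDerivAt_fst.add hasFDerivAt_snd)
    have h3 := (hasFDerivAt_fst.prodMk h1).prodMk (hasFDerivAt_snd.prodMk (h2.sub h1))
    have e : B.graph (a, b - a) = fun p : Cn q × Cn q =>
        ((p.1, B.h a p.1), (p.2, B.h b (p.1 + p.2) - B.h a p.1)) := by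
      funext p
      simp [graph, f, g]
    rw [e]
    exact h3
  have hd : HasFDerivAt (𝕜 := ℂ) (dilation (q := q) (m := m) l)
      ((ContinuousLinearMap.fst ℂ (Coord q m) (Coord q m)).prod
        (l • ContinuousLinearMap.snd ℂ (Coord q m) (Coord q m))) (B.graph (a, b - a) p) :=
    ContinuousLinearMap.hasFDerivAt ((ContinuousLinearMap.fst ℂ (Coord q m) (Coord q m)).prod
        (l • ContinuousLinearMap.snd ℂ (Coord q m) (Coord q m)))
  have e : dilation l (B.graph (a, b - a) p) = B.dilatedGraph l a b p := by
    simp [graph, f, g, dilation, dilatedGraph]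
  simp only [plaqueDensity, pullback, (hg.restrictScalars ℝ).fderiv, (hd.restrictScalars ℝ).fderiv,
    e]
  simp only [ContinuousAlternatingMap.compContinuousLinearMap_apply]
  congr 1

/-- Continuity jointly in parameters and base point provides the measurability for both the inner
and the outer integral. -/
lemma continuousOn_density (hB : B.IsLipschitz) (l : ℂ)
    {φ : Coord q m × Coord q m → Covector (Coord q m × Coord q m) (2 * q + 2 * q)}
    (hφ : Continuous φ) :
    ContinuousOn (fun s : (Cn m × Cn m) × (Cn q × Cn q) =>
        φ (B.dilatedGraph l s.1.1 s.1.2 s.2)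
          (fun j => B.dilatedTangent l s.1.1 s.1.2 s.2 (prodFrame q j)))
      ((B.transversal ×ˢ B.transversal) ×ˢ graphDomain q) := by
  have ma : Set.MapsTo (fun s : (Cn m × Cn m) × (Cn q × Cn q) => (s.1.1, s.2.1))
      ((B.transversal ×ˢ B.transversal) ×ˢ graphDomain q) (B.transversal ×ˢ polydisc q) :=
    fun s hs => ⟨hs.1.1, hs.2.1⟩
  have mb : Set.MapsTo (fun s : (Cn m × Cn m) × (Cn q × Cn q) => (s.1.2, s.2.1 + s.2.2))
      ((B.transversal ×ˢ B.transversal) ×ˢ graphDomain q) (B.transversal ×ˢ polydisc q) :=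
    fun s hs => ⟨hs.1.2, hs.2.2⟩
  have ca := B.continuousOn.comp (by fun_prop) ma
  have cb := B.continuousOn.comp (by fun_prop) mb
  have da := (continuousOn_fderiv_h hB).comp (by fun_prop) ma
  have db := (continuousOn_fderiv_h hB).comp (by fun_prop) mb
  simp only [Function.comp_def] at ca cb da db
  have cg : ContinuousOn (fun s : (Cn m × Cn m) × (Cn q × Cn q) =>
      B.dilatedGraph l s.1.1 s.1.2 s.2) ((B.transversal ×ˢ B.transversal) ×ˢ graphDomain q) := by
    unfold dilatedGraph
    fun_prop
  have ct : ContinuousOn (fun (s : (Cn m × Cn m) × (Cn q × Cn q)) (j : Fin (2 * q + 2 * q)) =>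
      B.dilatedTangent l s.1.1 s.1.2 s.2 (prodFrame q j))
      ((B.transversal ×ˢ B.transversal) ×ˢ graphDomain q) := by
    refine continuousOn_pi.2 fun j => ?_
    unfold dilatedTangent
    fun_prop
  exact (hφ.comp_continuousOn cg).eval ct

end FlowBox

/-! ### Uniform estimates near the diagonal -/

lemma norm_realFrame (d : ℕ) (j : Fin (2 * d)) : ‖realFrame d j‖ = 1 := by
  rw [realFrame, Pi.norm_single]
  split_ifs <;> simp

/-- The pairs of parameters in a fixed compact set, at distance at most `ε`. -/
def nearDiagonal (m : ℕ) (ε : ℝ) : Set (Cn m × Cn m) :=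
  {s | ‖s.1‖ ≤ 3 / 4 ∧ ‖s.2‖ ≤ 3 / 4 ∧ ‖s.1 - s.2‖ ≤ ε}

/-- The part of the parameter space of the plaques that `A_l` maps to a fixed neighbourhood of the
origin. -/
def shrunkBox (q : ℕ) (l : ℂ) : Set (Cn q × Cn q) :=
  Metric.ball 0 (1 / 32) ×ˢ Metric.ball 0 (1 / 32 / ‖l‖)

lemma shrunkBox_subset_graphDomain {q : ℕ} {l : ℂ} (hl : 1 ≤ ‖l‖) :
    shrunkBox q l ⊆ graphDomain q := by
  rintro p ⟨h1, h2⟩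
  rw [mem_ball_zero_iff] at h1 h2
  have h3 : 1 / 32 / ‖l‖ ≤ 1 / 32 := div_le_self (by norm_num) hl
  exact ⟨mem_ball_zero_iff.2 (by linarith),
    mem_ball_zero_iff.2 (by linarith [norm_add_le p.1 p.2])⟩

lemma measurableSet_shrunkBox (q : ℕ) (l : ℂ) : MeasurableSet (shrunkBox q l) :=
  measurableSet_ball.prod measurableSet_ball

lemma measurableSet_graphDomain (q : ℕ) : MeasurableSet (graphDomain q) := by
  have h : IsOpen (graphDomain q) :=
    (Metric.isOpen_ball.preimage continuous_fst).inter
      (Metric.isOpen_ball.preimage (continuous_fst.add continuous_snd))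
  exact h.measurableSet

lemma volume_shrunkBox_lt_top (q : ℕ) (l : ℂ) :
    (volume : Measure (Cn q × Cn q)) (shrunkBox q l) < ⊤ := by
  rw [shrunkBox, Measure.volume_eq_prod, Measure.prod_prod]
  exact ENNReal.mul_lt_top measure_ball_lt_top measure_ball_lt_top

/-- The `w'`-ball has real dimension `2q`, so its volume scales exactly as `|l|^(-2q)`; this offsets
the stretching of the `w'` directions. -/
lemma volume_real_shrunkBox {q : ℕ} {l : ℂ} (hl : 1 ≤ ‖l‖) :
    (volume : Measure (Cn q × Cn q)).real (shrunkBox q l) * ‖l‖ ^ (2 * q) =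
      (volume : Measure (Cn q × Cn q)).real (shrunkBox q 1) := by
  have hl0 : 0 < ‖l‖ := by linarith
  have hr : Module.finrank ℝ (Cn q) = 2 * q := by
    rw [Module.finrank_pi_fintype]
    simp [Complex.finrank_real_complex, mul_comm]
  have key : ∀ r : ℝ, 0 < r → (volume : Measure (Cn q)).real (Metric.ball 0 r) =
      r ^ (2 * q) * (volume : Measure (Cn q)).real (Metric.ball 0 1) := fun r h => by
    rw [measureReal_def, Measure.addHaar_ball_of_pos _ _ h, hr, ENNReal.toReal_mul,
      ENNReal.toReal_ofReal (by positivity), measureReal_def]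
  have hp : ∀ l : ℂ, (volume : Measure (Cn q × Cn q)).real (shrunkBox q l) =
      (volume : Measure (Cn q)).real (Metric.ball 0 (1 / 32)) *
        (volume : Measure (Cn q)).real (Metric.ball 0 (1 / 32 / ‖l‖)) := fun l => by
    rw [shrunkBox, Measure.volume_eq_prod, measureReal_prod_prod]
  rw [hp, hp, key (1 / 32 / ‖l‖) (by positivity), norm_one, div_one, div_pow,
    key (1 / 32) (by norm_num)]
  field_simp

namespace FlowBox

variable {q m : ℕ} {B : FlowBox q m}

/-- The estimates on the part of the dilated plaques close to the origin: the parameters are at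
distance `O(1 / |l|)`, and the dilated plaques have bounded slope. -/
lemma dilatedGraph_estimates {c : ℝ} (hc0 : 0 < c)
    (hc : ∀ a ∈ B.transversal, ∀ b ∈ B.transversal, ∀ x : Cn q, ‖x‖ ≤ 1 / 2 →
      c⁻¹ * ‖a - b‖ ≤ ‖B.h a x - B.h b x‖ ∧ ‖B.h a x - B.h b x‖ ≤ c * ‖a - b‖)
    {l : ℂ} (hl : 1 ≤ ‖l‖) {a b : Cn m} (ha : a ∈ B.transversal) (hb : b ∈ B.transversal)
    {p : Cn q × Cn q} (hp : B.dilatedGraph l a b p ∈ Metric.ball 0 (1 / 32)) :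
    p ∈ shrunkBox q l ∧ (a, b) ∈ nearDiagonal m (c / ‖l‖) ∧
      (∀ v, ‖B.dilatedTangent l a b p (v, 0)‖ ≤ (8 + 8 * c ^ 2) * ‖v‖) ∧
      ∀ v, ‖B.dilatedTangent l a b p (0, v)‖ ≤ 8 * ‖l‖ * ‖v‖ := by
  obtain ⟨x, w⟩ := p
  have hl0 : 0 < ‖l‖ := by linarith
  rw [mem_ball_zero_iff] at hp
  simp only [dilatedGraph, Prod.norm_mk, sup_lt_iff, norm_smul] at hp
  obtain ⟨⟨hx, hax⟩, hw, hbx⟩ := hp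
  have hw' : ‖w‖ < 1 / 32 := (le_mul_of_one_le_left (norm_nonneg _) hl).trans_lt hw
  have hbx' : ‖B.h b (x + w) - B.h a x‖ < 1 / 32 :=
    (le_mul_of_one_le_left (norm_nonneg _) hl).trans_lt hbx
  have hxw : ‖x + w‖ < 1 / 16 := by linarith [norm_add_le x w]
  have hlip : ∀ d ∈ B.transversal, ∀ s t : Cn q, ‖s‖ < 1 / 2 → ‖t‖ < 1 / 2 →
      ‖B.h d t - B.h d s‖ ≤ 8 * ‖t - s‖ := fun d hd s t hs ht => by
    have := norm_h_sub_h_le hd (x := s) (y := t) (δ := 1 / 4) (by norm_num) (by linarith)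
      (by linarith)
    norm_num at this
    exact this
  -- Since `d = h_d(0)`, this bounds the parameters: `‖a‖ < 9/32` and `‖b‖ < 1/16 + 8/16 = 9/16`,
  -- both below the `3/4` of `nearDiagonal`.
  have hcenter : ∀ d ∈ B.transversal, ∀ t : Cn q, ‖t‖ < 1 / 2 → ‖d‖ ≤ ‖B.h d t‖ + 8 * ‖t‖ :=
    fun d hd t ht => by
    have h1 := hlip d hd 0 t (by norm_num) ht
    rw [B.h_zero d hd, sub_zero] at h1
    linarith [norm_sub_norm_le d (B.h d t), norm_sub_rev d (B.h d t)]
  have hnb : ‖B.h b (x + w)‖ < 1 / 16 := by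
    linarith [norm_sub_norm_le (B.h b (x + w)) (B.h a x)]
  have hmove : ‖B.h b (x + w) - B.h b x‖ ≤ 8 * ‖w‖ := by
    have := hlip b hb x (x + w) (by linarith) (by linarith)
    rwa [add_sub_cancel_left] at this
  -- Compare the two plaques over the same point `x`. After multiplication by `|l|` the two error
  -- terms total at most `8/32 + 1/32 < 1`.
  have hab : ‖l‖ * ‖a - b‖ ≤ c := by
    have h1 := (hc a ha b hb x (by linarith)).1
    have h2 : ‖B.h a x - B.h b x‖ ≤ ‖B.h b (x + w) - B.h b x‖ + ‖B.h b (x + w) - B.h a x‖ := by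
      rw [← sub_sub_sub_cancel_left _ _ (B.h b (x + w))]
      exact norm_sub_le _ _
    have h3 : ‖l‖ * (c⁻¹ * ‖a - b‖) ≤ ‖l‖ * (8 * ‖w‖ + ‖B.h b (x + w) - B.h a x‖) := by
      gcongr; linarith
    have h4 : ‖l‖ * (c⁻¹ * ‖a - b‖) ≤ 1 := by linarith
    calc ‖l‖ * ‖a - b‖ = c * (‖l‖ * (c⁻¹ * ‖a - b‖)) := by field_simp
      _ ≤ c * 1 := by gcongr
      _ = c := mul_one c
  have hDa : ‖fderiv ℂ (B.h a) x‖ ≤ 8 := by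
    have := norm_fderiv_h_le ha (x := x) (δ := 1 / 4) (by norm_num) (by linarith)
    norm_num at this
    exact this
  have hDb : ‖fderiv ℂ (B.h b) (x + w)‖ ≤ 8 := by
    have := norm_fderiv_h_le hb (x := x + w) (δ := 1 / 4) (by norm_num) (by linarith)
    norm_num at this
    exact this
  -- With `δ = 1/4` the Cauchy bound is `64‖w‖ + 8c‖a - b‖`; now use `|l|‖w‖ < 1/32` and `|l|‖a - b‖
  -- ≤ c`.
  have hD : ‖l‖ * ‖fderiv ℂ (B.h b) (x + w) - fderiv ℂ (B.h a) x‖ ≤ 2 + 8 * c ^ 2 := by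
    have h1 := norm_fderiv_h_sub_fderiv_h_le ha hb (x := x) (w := w) (c := c) (δ := 1 / 4)
      (by norm_num) (by linarith) (by linarith)
      (fun t ht => (hc a ha b hb t (by linarith)).2)
    have h2 := mul_le_mul_of_nonneg_left h1 hl0.le
    have h3 : c * (‖l‖ * ‖a - b‖) ≤ c * c := mul_le_mul_of_nonneg_left hab hc0.le
    calc _ ≤ _ := h2
      _ = 64 * (‖l‖ * ‖w‖) + 8 * (c * (‖l‖ * ‖a - b‖)) := by ring
      _ ≤ 2 + 8 * c ^ 2 := by rw [sq]; linarith
  refine ⟨⟨by simpa using hx, ?_⟩, ⟨?_, ?_, ?_⟩, fun v => ?_, fun v => ?_⟩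
  · rw [mem_ball_zero_iff, lt_div_iff₀ hl0]; linarith
  · linarith [hcenter a ha x (by linarith)]
  · linarith [hcenter b hb (x + w) (by linarith)]
  · rw [le_div_iff₀ hl0]; linarith
  · have h1 : ‖fderiv ℂ (B.h a) x v‖ ≤ 8 * ‖v‖ :=
      ContinuousLinearMap.le_of_opNorm_le _ hDa v
    have h2 : ‖l‖ * ‖(fderiv ℂ (B.h b) (x + w) - fderiv ℂ (B.h a) x) v‖ ≤
        (2 + 8 * c ^ 2) * ‖v‖ := by
      calc _ ≤ ‖l‖ * (‖fderiv ℂ (B.h b) (x + w) - fderiv ℂ (B.h a) x‖ * ‖v‖) := by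
            gcongr; exact ContinuousLinearMap.le_opNorm _ v
        _ ≤ _ := by rw [← mul_assoc]; gcongr
    have hv := norm_nonneg v
    have hcv : 0 ≤ c ^ 2 * ‖v‖ := by positivity
    rw [sub_apply] at h2
    simp only [dilatedTangent, Prod.norm_mk, norm_smul, add_zero, norm_zero, mul_zero]
    refine max_le (max_le ?_ ?_) (max_le ?_ ?_) <;> linarith
  · have h1 : ‖fderiv ℂ (B.h b) (x + w) v‖ ≤ 8 * ‖v‖ :=
      ContinuousLinearMap.le_of_opNorm_le _ hDb v
    have h2 : ‖l‖ * ‖fderiv ℂ (B.h b) (x + w) v‖ ≤ ‖l‖ * (8 * ‖v‖) := by gcongr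
    have h3 : 0 ≤ ‖l‖ * ‖v‖ := by positivity
    simp only [dilatedTangent, Prod.norm_mk, norm_smul, zero_add, map_zero, norm_zero, sub_zero]
    refine max_le (max_le ?_ ?_) (max_le ?_ ?_) <;> linarith

/-- The restriction of `φ` to the dilated plaques, as a density. -/
def dilatedDensity (B : FlowBox q m) (l : ℂ)
    (φ : Coord q m × Coord q m → Covector (Coord q m × Coord q m) (2 * q + 2 * q))
    (s : Cn m × Cn m) (p : Cn q × Cn q) : ℂ :=
  φ (B.dilatedGraph l s.1 s.2 p) (fun j => B.dilatedTangent l s.1 s.2 p (prodFrame q j))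

/-- An alternating form is bounded by its norm times the product of the norms of its arguments: `2q`
bounded vectors and `2q` vectors of size `O(|l|)`. -/
lemma norm_dilatedDensity_le {c : ℝ} (hc0 : 0 < c)
    (hc : ∀ a ∈ B.transversal, ∀ b ∈ B.transversal, ∀ x : Cn q, ‖x‖ ≤ 1 / 2 →
      c⁻¹ * ‖a - b‖ ≤ ‖B.h a x - B.h b x‖ ∧ ‖B.h a x - B.h b x‖ ≤ c * ‖a - b‖)
    {l : ℂ} (hl : 1 ≤ ‖l‖)
    {φ : Coord q m × Coord q m → Covector (Coord q m × Coord q m) (2 * q + 2 * q)} {N : ℝ}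
    (hN : ∀ y, ‖φ y‖ ≤ N) (hφ : ∀ y ∉ Metric.ball 0 (1 / 32), φ y = 0)
    {s : Cn m × Cn m} (hs : s ∈ B.transversal ×ˢ B.transversal) (p : Cn q × Cn q) :
    ‖B.dilatedDensity l φ s p‖ ≤ N * ((8 + 8 * c ^ 2) ^ (2 * q) * (8 * ‖l‖) ^ (2 * q)) := by
  have hN0 : 0 ≤ N := (norm_nonneg _).trans (hN 0)
  by_cases hp : B.dilatedGraph l s.1 s.2 p ∈ Metric.ball 0 (1 / 32)
  · obtain ⟨-, -, h1, h2⟩ := dilatedGraph_estimates hc0 hc hl hs.1 hs.2 hp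
    refine (ContinuousAlternatingMap.le_opNorm _ _).trans ?_
    refine mul_le_mul (hN _) ?_ (by positivity) hN0
    rw [Fin.prod_univ_add]
    simp only [prodFrame, Fin.append_left, Fin.append_right]
    refine mul_le_mul ?_ ?_ (by positivity) (by positivity)
    · refine (Finset.prod_le_prod (g := fun _ => (8 + 8 * c ^ 2)) (fun _ _ => norm_nonneg _)
        fun j _ => ?_).trans_eq (by simp)
      simpa [norm_realFrame] using h1 (realFrame q j)
    · refine (Finset.prod_le_prod (g := fun _ => (8 * ‖l‖)) (fun _ _ => norm_nonneg _)
        fun j _ => ?_).trans_eq (by simp)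
      simpa [norm_realFrame] using h2 (realFrame q j)
  · rw [dilatedDensity, hφ _ hp, ContinuousAlternatingMap.coe_zero, Pi.zero_apply, norm_zero]
    positivity

lemma dilatedDensity_eq_zero {c : ℝ} (hc0 : 0 < c)
    (hc : ∀ a ∈ B.transversal, ∀ b ∈ B.transversal, ∀ x : Cn q, ‖x‖ ≤ 1 / 2 →
      c⁻¹ * ‖a - b‖ ≤ ‖B.h a x - B.h b x‖ ∧ ‖B.h a x - B.h b x‖ ≤ c * ‖a - b‖)
    {l : ℂ} (hl : 1 ≤ ‖l‖)
    {φ : Coord q m × Coord q m → Covector (Coord q m × Coord q m) (2 * q + 2 * q)}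
    (hφ : ∀ y ∉ Metric.ball 0 (1 / 32), φ y = 0)
    {s : Cn m × Cn m} (hs : s ∈ B.transversal ×ˢ B.transversal) {p : Cn q × Cn q}
    (h : p ∉ shrunkBox q l ∨ s ∉ nearDiagonal m (c / ‖l‖)) :
    B.dilatedDensity l φ s p = 0 := by
  by_cases hp : B.dilatedGraph l s.1 s.2 p ∈ Metric.ball 0 (1 / 32)
  · obtain ⟨h1, h2, -⟩ := dilatedGraph_estimates hc0 hc hl hs.1 hs.2 hp
    exact (h.elim (fun h => h h1) fun h => h h2).elim
  · rw [dilatedDensity, hφ _ hp, ContinuousAlternatingMap.coe_zero, Pi.zero_apply]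

lemma integrableOn_dilatedDensity (hB : B.IsLipschitz) {l : ℂ} (hl : 1 ≤ ‖l‖)
    {φ : Coord q m × Coord q m → Covector (Coord q m × Coord q m) (2 * q + 2 * q)} {N : ℝ}
    (hφc : Continuous φ) (hN : ∀ y, ‖φ y‖ ≤ N) (hφ : ∀ y ∉ Metric.ball 0 (1 / 32), φ y = 0)
    {s : Cn m × Cn m} (hs : s ∈ B.transversal ×ˢ B.transversal) :
    IntegrableOn (B.dilatedDensity l φ s) (graphDomain q) := by
  obtain ⟨c, hc0, hc⟩ := hB (1 / 2) (by norm_num) (by norm_num)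
  have hcont : ContinuousOn (B.dilatedDensity l φ s) (graphDomain q) :=
    (continuousOn_density hB l hφc).comp (f := fun p : Cn q × Cn q => (s, p)) (by fun_prop)
      fun p hp => ⟨hs, hp⟩
  have hbox : IntegrableOn (B.dilatedDensity l φ s) (shrunkBox q l) :=
    IntegrableOn.of_bound (volume_shrunkBox_lt_top q l)
      ((hcont.mono (shrunkBox_subset_graphDomain hl)).aestronglyMeasurable
        (measurableSet_shrunkBox q l))
      _ (Eventually.of_forall fun p => norm_dilatedDensity_le hc0 hc hl hN hφ hs p)
  exact hbox.of_forall_sdiff_eq_zero (measurableSet_graphDomain q)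
    fun p hp => dilatedDensity_eq_zero hc0 hc hl hφ hs (.inl hp.2)

/-- The mass of the dilated plaques near the origin is uniformly bounded, and vanishes unless the
two parameters are at distance `O(1 / |l|)`. -/
lemma norm_setIntegral_dilatedDensity_le {c : ℝ} (hc0 : 0 < c)
    (hc : ∀ a ∈ B.transversal, ∀ b ∈ B.transversal, ∀ x : Cn q, ‖x‖ ≤ 1 / 2 →
      c⁻¹ * ‖a - b‖ ≤ ‖B.h a x - B.h b x‖ ∧ ‖B.h a x - B.h b x‖ ≤ c * ‖a - b‖)
    {l : ℂ} (hl : 1 ≤ ‖l‖)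
    {φ : Coord q m × Coord q m → Covector (Coord q m × Coord q m) (2 * q + 2 * q)} {N : ℝ}
    (hN : ∀ y, ‖φ y‖ ≤ N) (hφ : ∀ y ∉ Metric.ball 0 (1 / 32), φ y = 0)
    {s : Cn m × Cn m} (hs : s ∈ B.transversal ×ˢ B.transversal) :
    ‖∫ p in graphDomain q, B.dilatedDensity l φ s p‖ ≤
      (nearDiagonal m (c / ‖l‖)).indicator (fun _ => N * ((8 * (8 + 8 * c ^ 2)) ^ (2 * q) *
        (volume : Measure (Cn q × Cn q)).real (shrunkBox q 1))) s := by
  by_cases hE : s ∈ nearDiagonal m (c / ‖l‖)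
  · rw [Set.indicator_of_mem hE, setIntegral_eq_of_subset_of_forall_sdiff_eq_zero
      (measurableSet_graphDomain q) (shrunkBox_subset_graphDomain hl)
      fun p hp => dilatedDensity_eq_zero hc0 hc hl hφ hs (.inl hp.2)]
    refine (norm_setIntegral_le_of_norm_le_const (volume_shrunkBox_lt_top q l)
      fun p _ => norm_dilatedDensity_le hc0 hc hl hN hφ hs p).trans_eq ?_
    -- The powers of `|l|` cancel here, leaving a bound independent of `l`.
    rw [← volume_real_shrunkBox hl, mul_pow, mul_pow]
    ring
  · rw [Set.indicator_of_notMem hE, setIntegral_eq_zero_of_forall_eq_zero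
      fun p _ => dilatedDensity_eq_zero hc0 hc hl hφ hs (.inr hE), norm_zero]

end FlowBox

/-! ### The transverse measure near the diagonal -/

lemma sigmaFinite_of_finite_on_compacts {m : ℕ} {μ : Measure (Cn m)}
    (hμ : μ (polydisc m)ᶜ = 0) (hfin : ∀ C ⊆ polydisc m, IsCompact C → μ C < ⊤) :
    SigmaFinite μ := by
  -- Closed balls exhaust only the open polydisc; adding its null complement to each makes them
  -- cover the whole space.
  refine ⟨⟨⟨fun n => Metric.closedBall 0 (1 - 1 / ((n : ℝ) + 1)) ∪ (polydisc m)ᶜ,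
    fun _ => trivial, fun n => ?_, Set.eq_univ_of_forall fun x => ?_⟩⟩⟩
  · refine measure_union_lt_top (hfin _ (Metric.closedBall_subset_ball ?_)
      (isCompact_closedBall _ _)) (by rw [hμ]; exact ENNReal.zero_lt_top)
    linarith [Nat.one_div_pos_of_nat (α := ℝ) (n := n)]
  · rw [Set.mem_iUnion]
    by_cases hx : x ∈ polydisc m
    · have hx1 : ‖x‖ < 1 := mem_ball_zero_iff.1 hx
      obtain ⟨n, hn⟩ := exists_nat_one_div_lt (sub_pos.2 hx1)
      exact ⟨n, .inl (mem_closedBall_zero_iff.2 (by linarith))⟩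
    · exact ⟨0, .inr hx⟩

lemma isClosed_nearDiagonal (m : ℕ) (ε : ℝ) : IsClosed (nearDiagonal m ε) :=
  (isClosed_le continuous_fst.norm continuous_const).inter
    ((isClosed_le continuous_snd.norm continuous_const).inter
      (isClosed_le (continuous_fst.sub continuous_snd).norm continuous_const))

lemma prod_nearDiagonal_lt_top {m : ℕ} {μ : Measure (Cn m)} [SFinite μ]
    (hfin : ∀ C ⊆ polydisc m, IsCompact C → μ C < ⊤) (ε : ℝ) :
    μ.prod μ (nearDiagonal m ε) < ⊤ := by
  have hball : μ (Metric.closedBall 0 (3 / 4)) < ⊤ :=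
    hfin _ (Metric.closedBall_subset_ball (by norm_num)) (isCompact_closedBall _ _)
  refine lt_of_le_of_lt (measure_mono (t := Metric.closedBall 0 (3 / 4) ×ˢ
    Metric.closedBall 0 (3 / 4)) fun s hs => ?_) ?_
  · exact ⟨mem_closedBall_zero_iff.2 hs.1, mem_closedBall_zero_iff.2 hs.2.1⟩
  · rw [Measure.prod_prod]
    exact ENNReal.mul_lt_top hball hball

/-- Fubini: every slice of the diagonal is a single point. -/
lemma prod_diagonal_eq_zero {m : ℕ} {μ : Measure (Cn m)} [SFinite μ] (hdiff : ∀ a, μ {a} = 0) :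
    μ.prod μ (Set.diagonal (Cn m)) = 0 := by
  rw [Measure.measure_prod_null isClosed_diagonal.measurableSet]
  refine Eventually.of_forall fun a => ?_
  have : Prod.mk a ⁻¹' Set.diagonal (Cn m) = {a} := by
    ext b
    simp [eq_comm]
  simp [this, hdiff]

/-- A diffuse measure does not charge the diagonal. -/
lemma tendsto_prod_nearDiagonal {m : ℕ} {μ : Measure (Cn m)} [SFinite μ]
    (hdiff : ∀ a, μ {a} = 0) (hfin : ∀ C ⊆ polydisc m, IsCompact C → μ C < ⊤) {c : ℝ}
    (hc : 0 < c) :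
    Tendsto (fun l : ℂ => (μ.prod μ).real (nearDiagonal m (c / ‖l‖)))
      (Bornology.cobounded ℂ) (𝓝 0) := by
  have hinter : μ.prod μ (⋂ ε > (0 : ℝ), nearDiagonal m ε) = 0 := by
    refine measure_mono_null (fun s hs => ?_) (prod_diagonal_eq_zero hdiff)
    simp only [Set.mem_iInter] at hs
    have h : ‖s.1 - s.2‖ ≤ 0 := le_of_forall_pos_le_add fun ε hε => by
      simpa using (hs ε hε).2.2
    exact sub_eq_zero.1 (norm_le_zero_iff.1 h)
  -- Continuity from above; it needs finite mass for some `ε`, which the bound `3/4` on the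
  -- parameters guarantees.
  have h1 := tendsto_measure_biInter_gt (μ := μ.prod μ) (s := nearDiagonal m) (a := 0)
    (fun ε _ => (isClosed_nearDiagonal m ε).measurableSet.nullMeasurableSet)
    (fun i j _ hij s hs => ⟨hs.1, hs.2.1, hs.2.2.trans hij⟩)
    ⟨1, one_pos, (prod_nearDiagonal_lt_top hfin 1).ne⟩
  rw [hinter] at h1
  have h2 : Tendsto (fun l : ℂ => c / ‖l‖) (Bornology.cobounded ℂ) (𝓝[>] 0) := by
    refine tendsto_nhdsWithin_iff.2
      ⟨tendsto_norm_cobounded_atTop.const_div_atTop c, ?_⟩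
    filter_upwards [tendsto_norm_cobounded_atTop.eventually_gt_atTop 0] with l hl
    exact div_pos hc hl
  have h3 := (ENNReal.tendsto_toReal ENNReal.zero_ne_top).comp (h1.comp h2)
  simpa [Function.comp_def, measureReal_def] using h3

/-- The change of parameters `(a, b) ↦ (a, b - a)`. -/
def shearEquiv (m : ℕ) : Cn m × Cn m ≃ᵐ Cn m × Cn m where
  toFun p := (p.1, p.2 - p.1)
  invFun p := (p.1, p.2 + p.1)
  left_inv p := by simp
  right_inv p := by simp
  measurable_toFun := measurable_fst.prodMk (measurable_snd.sub measurable_fst)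
  measurable_invFun := measurable_fst.prodMk (measurable_snd.add measurable_fst)

/-- Writing the shear as a measurable equivalence lets integrals and integrability be transferred
with no measurability condition on the integrand. -/
lemma productMeasure_eq_map {m : ℕ} (μ : Measure (Cn m)) :
    productMeasure μ = (μ.prod μ).map (shearEquiv m) := rfl

/-! ### Pairing the dilated product cycle with forms supported near the origin. -/

namespace FlowBox

variable {q m : ℕ} {B : FlowBox q m} {μ : Measure (Cn m)}

lemma ae_mem_transversal_prod [SFinite μ] (hμ : μ B.transversalᶜ = 0) :
    ∀ᵐ s ∂(μ.prod μ), s ∈ B.transversal ×ˢ B.transversal := by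
  have h : ∀ᵐ a ∂μ, a ∈ B.transversal := mem_ae_iff.2 hμ
  filter_upwards [Measure.quasiMeasurePreserving_fst.ae h,
    Measure.quasiMeasurePreserving_snd.ae h] with s h1 h2
  exact ⟨h1, h2⟩

lemma aestronglyMeasurable_setIntegral_dilatedDensity (hB : B.IsLipschitz) [SFinite μ]
    (hμ : μ B.transversalᶜ = 0) (l : ℂ)
    {φ : Coord q m × Coord q m → Covector (Coord q m × Coord q m) (2 * q + 2 * q)}
    (hφc : Continuous φ) :
    AEStronglyMeasurable (fun s => ∫ p in graphDomain q, B.dilatedDensity l φ s p)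
      (μ.prod μ) := by
  -- The transversal need not be measurable, so it is replaced by a measurable subset `Zᶜ` of full
  -- measure.
  obtain ⟨Z, hZ, hZm, hZ0⟩ := exists_measurable_superset_of_null hμ
  have hK : Zᶜ ⊆ B.transversal := Set.compl_subset_comm.1 hZ
  have hfull : (μ.restrict Zᶜ).prod (μ.restrict Zᶜ) = μ.prod μ := by
    rw [Measure.restrict_eq_self_of_ae_mem (s := Zᶜ) (compl_mem_ae_iff.2 hZ0)]
  have hcont : ContinuousOn (fun s : (Cn m × Cn m) × (Cn q × Cn q) =>
      B.dilatedDensity l φ s.1 s.2) ((Zᶜ ×ˢ Zᶜ) ×ˢ graphDomain q) :=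
    (continuousOn_density hB l hφc).mono (Set.prod_mono (Set.prod_mono hK hK) subset_rfl)
  have hmeas := hcont.aestronglyMeasurable (μ := (μ.prod μ).prod volume)
    ((hZm.compl.prod hZm.compl).prod (measurableSet_graphDomain q))
  rw [← Measure.prod_restrict, ← Measure.prod_restrict, hfull] at hmeas
  exact hmeas.integral_prod_right'

lemma plaqueCurrent_pullback_dilation {s : Cn m × Cn m}
    (hs : s ∈ B.transversal ×ˢ B.transversal) (l : ℂ)
    (φ : Coord q m × Coord q m → Covector (Coord q m × Coord q m) (2 * q + 2 * q)) :
    B.plaqueCurrent (shearEquiv m s) (pullback (dilation l) φ) =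
      ∫ p in graphDomain q, B.dilatedDensity l φ s p :=
  setIntegral_congr_fun (measurableSet_graphDomain q) fun _ hp =>
    plaqueDensity_pullback_dilation hs.1 hs.2 hp l φ

lemma productCycle_pullback_dilation [SFinite μ] (hμ : μ B.transversalᶜ = 0) (l : ℂ)
    (φ : Coord q m × Coord q m → Covector (Coord q m × Coord q m) (2 * q + 2 * q)) :
    B.productCycle μ (pullback (dilation l) φ) =
      ∫ s, (∫ p in graphDomain q, B.dilatedDensity l φ s p) ∂(μ.prod μ) := by
  rw [productCycle, productMeasure_eq_map, integral_map_equiv]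
  refine integral_congr_ae ?_
  filter_upwards [ae_mem_transversal_prod hμ] with s hs
  exact plaqueCurrent_pullback_dilation hs l φ

lemma integrable_setIntegral_dilatedDensity (hB : B.IsLipschitz) [SFinite μ]
    (hμ : μ B.transversalᶜ = 0) (hfin : ∀ C ⊆ polydisc m, IsCompact C → μ C < ⊤)
    {l : ℂ} (hl : 1 ≤ ‖l‖)
    {φ : Coord q m × Coord q m → Covector (Coord q m × Coord q m) (2 * q + 2 * q)} {N : ℝ}
    (hφc : Continuous φ) (hN : ∀ y, ‖φ y‖ ≤ N) (hφ : ∀ y ∉ Metric.ball 0 (1 / 32), φ y = 0) :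
    Integrable (fun s => ∫ p in graphDomain q, B.dilatedDensity l φ s p) (μ.prod μ) := by
  obtain ⟨c, hc0, hc⟩ := hB (1 / 2) (by norm_num) (by norm_num)
  refine Integrable.mono' (g := (nearDiagonal m (c / ‖l‖)).indicator fun _ =>
    N * ((8 * (8 + 8 * c ^ 2)) ^ (2 * q) *
      (volume : Measure (Cn q × Cn q)).real (shrunkBox q 1))) ?_
    (aestronglyMeasurable_setIntegral_dilatedDensity hB hμ l hφc) ?_
  · exact (integrable_indicator_iff (isClosed_nearDiagonal m _).measurableSet).2
      (integrableOn_const (prod_nearDiagonal_lt_top hfin _).ne)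
  · filter_upwards [ae_mem_transversal_prod hμ] with s hs
    exact norm_setIntegral_dilatedDensity_le hc0 hc hl hN hφ hs

/-- The defining integrals of `(A_l)_* (T ⊗ T)` converge near the origin. -/
lemma pairingConverges_pullback_dilation (hB : B.IsLipschitz) [SFinite μ]
    (hμ : μ B.transversalᶜ = 0) (hfin : ∀ C ⊆ polydisc m, IsCompact C → μ C < ⊤)
    {l : ℂ} (hl : 1 ≤ ‖l‖)
    {φ : Coord q m × Coord q m → Covector (Coord q m × Coord q m) (2 * q + 2 * q)} {N : ℝ}
    (hφc : Continuous φ) (hN : ∀ y, ‖φ y‖ ≤ N) (hφ : ∀ y ∉ Metric.ball 0 (1 / 32), φ y = 0) :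
    B.PairingConverges μ (pullback (dilation l) φ) := by
  rw [PairingConverges, productMeasure_eq_map, (shearEquiv m).measurableEmbedding.ae_map_iff,
    integrable_map_equiv]
  constructor
  · filter_upwards [ae_mem_transversal_prod hμ] with s hs
    refine (integrableOn_congr_fun (fun p hp => ?_) (measurableSet_graphDomain q)).2
      (integrableOn_dilatedDensity hB hl hφc hN hφ hs)
    exact plaqueDensity_pullback_dilation hs.1 hs.2 hp l φ
  · refine (integrable_setIntegral_dilatedDensity hB hμ hfin hl hφc hN hφ).congr ?_
    filter_upwards [ae_mem_transversal_prod hμ] with s hs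
    exact (plaqueCurrent_pullback_dilation hs l φ).symm

/-- The dilated product cycle is controlled by the sup norm of the form and by the mass of a
shrinking neighbourhood of the diagonal. -/
lemma exists_norm_productCycle_le (hB : B.IsLipschitz) [SFinite μ]
    (hμ : μ B.transversalᶜ = 0) (hfin : ∀ C ⊆ polydisc m, IsCompact C → μ C < ⊤) :
    ∃ c M : ℝ, 0 < c ∧ ∀ l : ℂ, 1 ≤ ‖l‖ →
      ∀ (φ : Coord q m × Coord q m → Covector (Coord q m × Coord q m) (2 * q + 2 * q)) (N : ℝ),
        (∀ y, ‖φ y‖ ≤ N) → (∀ y ∉ Metric.ball 0 (1 / 32), φ y = 0) →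
        ‖B.productCycle μ (pullback (dilation l) φ)‖ ≤
          M * (μ.prod μ).real (nearDiagonal m (c / ‖l‖)) * N := by
  obtain ⟨c, hc0, hc⟩ := hB (1 / 2) (by norm_num) (by norm_num)
  refine ⟨c, (8 * (8 + 8 * c ^ 2)) ^ (2 * q) *
    (volume : Measure (Cn q × Cn q)).real (shrunkBox q 1), hc0, fun l hl φ N hN hφ => ?_⟩
  have hE := (isClosed_nearDiagonal m (c / ‖l‖)).measurableSet
  rw [productCycle_pullback_dilation hμ]
  refine (norm_integral_le_of_norm_le (g := (nearDiagonal m (c / ‖l‖)).indicator fun _ =>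
    N * ((8 * (8 + 8 * c ^ 2)) ^ (2 * q) *
      (volume : Measure (Cn q × Cn q)).real (shrunkBox q 1)))
    ((integrable_indicator_iff hE).2
      (integrableOn_const (prod_nearDiagonal_lt_top hfin _).ne)) ?_).trans_eq ?_
  · filter_upwards [ae_mem_transversal_prod hμ] with s hs
    exact norm_setIntegral_dilatedDensity_le hc0 hc hl hN hφ hs
  · rw [integral_indicator_const _ hE, smul_eq_mul]
    ring

end FlowBox

/-- The neighbourhood of the origin on which the dilated cycles are considered. -/
def originBox (q m : ℕ) : Opens (Coord q m × Coord q m) :=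
  ⟨Metric.ball 0 (1 / 32), Metric.isOpen_ball⟩

lemma originBox_subset_image_dilation {q m : ℕ} {l : ℂ} (hl : 1 ≤ ‖l‖) :
    (originBox q m : Set (Coord q m × Coord q m)) ⊆ dilation l '' productBox q m := by
  rintro ⟨z, w⟩ h
  have h' : ‖z‖ < 1 / 32 ∧ ‖w‖ < 1 / 32 := by
    have := mem_ball_zero_iff.1 h
    rwa [Prod.norm_mk, sup_lt_iff] at this
  have hl0 : l ≠ 0 := norm_pos_iff.1 (by linarith)
  have hball : ∀ x : Coord q m, ‖x‖ < 1 → x ∈ polydisc q ×ˢ polydisc m := fun x hx => by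
    rw [Prod.norm_def, sup_lt_iff] at hx
    exact ⟨mem_ball_zero_iff.2 hx.1, mem_ball_zero_iff.2 hx.2⟩
  have hw : ‖l⁻¹ • w‖ ≤ ‖w‖ := by
    rw [norm_smul, norm_inv]
    exact mul_le_of_le_one_left (norm_nonneg _) (inv_le_one_of_one_le₀ hl)
  refine ⟨(z, l⁻¹ • w), ⟨hball _ (by linarith), hball _ ?_⟩, ?_⟩
  · exact (norm_add_le _ _).trans_lt (by linarith)
  · simp [dilation, smul_inv_smul₀ hl0]

/-! ### The dilated cycles as currents. -/

section TestForm

variable {q m k : ℕ} (φ : TestForm (originBox q m) k)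

lemma TestForm.eq_zero_of_notMem (y : Coord q m × Coord q m) (hy : y ∉ Metric.ball 0 (1 / 32)) :
    φ y = 0 :=
  image_eq_zero_of_notMem_tsupport fun h => hy (φ.tsupport_subset h)

lemma TestForm.norm_apply_le (y : Coord q m × Coord q m) :
    ‖φ y‖ ≤ ‖TestFunction.toBoundedContinuousFunctionCLM ℝ φ‖ :=
  (TestFunction.toBoundedContinuousFunctionCLM ℝ φ).norm_coe_le_norm y

end TestForm

namespace FlowBox

variable {q m : ℕ} {B : FlowBox q m} {μ : Measure (Cn m)}

/-- The current `(A_l)_* (T ⊗ T)` near the origin. -/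
lemma exists_current (hB : B.IsLipschitz) [SFinite μ] (hμ : μ B.transversalᶜ = 0)
    (hfin : ∀ C ⊆ polydisc m, IsCompact C → μ C < ⊤) {l : ℂ} (hl : 1 ≤ ‖l‖) :
    ∃ T : Current (originBox q m) (2 * q + 2 * q), ∀ φ,
      T φ = pushforward (dilation l) (B.productCycle μ) φ := by
  have hint : ∀ (φ : TestForm (originBox q m) (2 * q + 2 * q)),
      ∀ s ∈ B.transversal ×ˢ B.transversal,
        IntegrableOn (B.dilatedDensity l φ s) (graphDomain q) := fun φ s hs =>
    integrableOn_dilatedDensity hB hl φ.continuous (TestForm.norm_apply_le φ)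
      (TestForm.eq_zero_of_notMem φ) hs
  have hint' : ∀ (φ : TestForm (originBox q m) (2 * q + 2 * q)),
      Integrable (fun s => ∫ p in graphDomain q, B.dilatedDensity l φ s p) (μ.prod μ) := fun φ =>
    integrable_setIntegral_dilatedDensity hB hμ hfin hl φ.continuous (TestForm.norm_apply_le φ)
      (TestForm.eq_zero_of_notMem φ)
  let S : TestForm (originBox q m) (2 * q + 2 * q) →ₗ[ℝ] ℂ :=
    { toFun := fun φ => pushforward (dilation l) (B.productCycle μ) φ
      map_add' := fun φ ψ => by
        simp only [pushforward, productCycle_pullback_dilation hμ]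
        rw [← integral_add (hint' φ) (hint' ψ)]
        refine integral_congr_ae ?_
        filter_upwards [ae_mem_transversal_prod hμ] with s hs
        rw [← integral_add (hint φ s hs) (hint ψ s hs)]
        rfl
      map_smul' := fun r φ => by
        simp only [pushforward, productCycle_pullback_dilation hμ, RingHom.id_apply]
        rw [← integral_smul]
        simp_rw [← integral_smul]
        rfl }
  have hS : Continuous S := by
    -- By linearity continuity at `0` suffices, and the sup norm that dominates the pairing is
    -- continuous on test forms.
    obtain ⟨c, M, -, hM⟩ := exists_norm_productCycle_le hB hμ hfin
    refine continuous_of_continuousAt_zero S ?_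
    rw [ContinuousAt, map_zero]
    have hlim : Tendsto (fun φ : TestForm (originBox q m) (2 * q + 2 * q) =>
        M * (μ.prod μ).real (nearDiagonal m (c / ‖l‖)) *
          ‖TestFunction.toBoundedContinuousFunctionCLM ℝ φ‖) (𝓝 0) (𝓝 0) := by
      have h : Continuous fun φ : TestForm (originBox q m) (2 * q + 2 * q) =>
          M * (μ.prod μ).real (nearDiagonal m (c / ‖l‖)) *
            ‖TestFunction.toBoundedContinuousFunctionCLM ℝ φ‖ :=
        continuous_const.mul (TestFunction.toBoundedContinuousFunctionCLM ℝ).continuous.norm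
      simpa only [map_zero, norm_zero, mul_zero] using h.tendsto 0
    exact squeeze_zero_norm (fun φ => hM l hl φ _ (TestForm.norm_apply_le φ)
      (TestForm.eq_zero_of_notMem φ)) hlim
  exact ⟨⟨S, hS⟩, fun φ => rfl⟩

end FlowBox

end FoliatedCycle

end

/-- Let `B` be a flow box of a Lipschitz lamination and `μ` a diffuse positive Radon measure on
its transversal. Then there is a neighbourhood `U` of the origin, contained in the dilated boxes
`A_l (B × B)` for `|l| ≥ 1`, on which all `(A_l)_* (T ⊗ T)`, `|l| ≥ 1`, are well defined currents
that converge weakly to `0` as `|l| → ∞`. -/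
theorem mainTheorem2 {q m : ℕ} (B : FoliatedCycle.FlowBox q m) (hB : B.IsLipschitz)
    (μ : Measure (Fin m → ℂ)) (hdiff : ∀ a, μ {a} = 0) (hμ : μ B.transversalᶜ = 0)
    (hfin : ∀ C ⊆ FoliatedCycle.polydisc m, IsCompact C → μ C < ⊤) :
    ∃ U : Opens (FoliatedCycle.Coord q m × FoliatedCycle.Coord q m), 0 ∈ U ∧
      (∀ l : ℂ, 1 ≤ ‖l‖ →
        (U : Set (FoliatedCycle.Coord q m × FoliatedCycle.Coord q m)) ⊆
          FoliatedCycle.dilation l '' FoliatedCycle.productBox q m) ∧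
      ∃ T : ℂ → FoliatedCycle.Current U (2 * q + 2 * q),
        (∀ l : ℂ, 1 ≤ ‖l‖ → ∀ φ : FoliatedCycle.TestForm U (2 * q + 2 * q),
          B.PairingConverges μ (FoliatedCycle.pullback (FoliatedCycle.dilation l) φ) ∧
          T l φ =
            FoliatedCycle.pushforward (FoliatedCycle.dilation l) (B.productCycle μ) φ) ∧
        ∀ φ : FoliatedCycle.TestForm U (2 * q + 2 * q),
          Tendsto (fun l => T l φ) (Bornology.cobounded ℂ) (𝓝 0) := by
  have hμd : μ (FoliatedCycle.polydisc m)ᶜ = 0 :=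
    measure_mono_null (Set.compl_subset_compl.2 B.transversal_subset) hμ
  have : SigmaFinite μ := FoliatedCycle.sigmaFinite_of_finite_on_compacts hμd hfin
  have hcur : ∀ l : ℂ, ∃ T : FoliatedCycle.Current (FoliatedCycle.originBox q m) (2 * q + 2 * q),
      1 ≤ ‖l‖ → ∀ φ, T φ =
        FoliatedCycle.pushforward (FoliatedCycle.dilation l) (B.productCycle μ) φ := fun l => by
    by_cases hl : 1 ≤ ‖l‖
    · obtain ⟨T, hT⟩ := FoliatedCycle.FlowBox.exists_current hB hμ hfin hl
      exact ⟨T, fun _ => hT⟩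
    -- For `‖l‖ < 1` nothing is claimed, and the zero current serves as a default; the limit sees
    -- only large `l`.
    · exact ⟨0, fun h => (hl h).elim⟩
  choose T hT using hcur
  refine ⟨FoliatedCycle.originBox q m, Metric.mem_ball_self (by norm_num),
    fun l hl => FoliatedCycle.originBox_subset_image_dilation hl, T,
    fun l hl φ => ⟨?_, hT l hl φ⟩, fun φ => ?_⟩
  · exact FoliatedCycle.FlowBox.pairingConverges_pullback_dilation hB hμ hfin hl φ.continuous
      (FoliatedCycle.TestForm.norm_apply_le φ) (FoliatedCycle.TestForm.eq_zero_of_notMem φ)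
  · obtain ⟨c, M, hc, hM⟩ := FoliatedCycle.FlowBox.exists_norm_productCycle_le hB hμ hfin
    have hlim := ((FoliatedCycle.tendsto_prod_nearDiagonal hdiff hfin hc).const_mul M).mul_const
      ‖TestFunction.toBoundedContinuousFunctionCLM ℝ φ‖
    rw [mul_zero, zero_mul] at hlim
    refine squeeze_zero_norm' ?_ hlim
    filter_upwards [tendsto_norm_cobounded_atTop.eventually_ge_atTop 1] with l hl
    rw [hT l hl φ]
    exact hM l hl φ _ (FoliatedCycle.TestForm.norm_apply_le φ)
      (FoliatedCycle.TestForm.eq_zero_of_notMem φ)
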